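/- Let $X$ be a set and $R$ a binary relation on $X$ (all variables below range over $X$). Consider the following 24 basic properties. - Refl: $\forall x\; xRx$. - Irrefl: $\forall x\; \lnot xRx$. - CoRefl: $xRy\to x=y$. - LfQuasiRefl: $xRy\to xRx$. - RgQuasiRefl: $xRy\to yRy$. - QuasiRefl: both LfQuasiRefl and RgQuasiRefl. - Sym: $xRy\to yRx$. - ASym: $xRy\to\lnot yRx$. - AntiSym: $xRy\land x\ne y\to\lnot yRx$. - SemiConnex: $xRy\lor yRx\lor x=y$. - Connex: $xRy\lor yRx$. - Trans: $xRy\land yRz\to xRz$. - AntiTrans: $xRy\land yRz\to\lnot xRz$. - QuasiTrans: $xRy\land\lnot yRx\land yRz\land\lnot zRy\to xRz\land\lnot zRx$. - RgEucl: $xRy\land xRz\to yRz$. - LfEucl: $yRx\land zRx\to yRz$. - SemiOrd1: $wRx\land\lnot xRy\land\lnot yRx\land yRz\to wRz$. - SemiOrd2: $xRy\land yRz\to wRx\lor xRw\lor wRy\lor yRw\lor wRz\lor zRw$. - RgSerial: $\forall x\,\exists y\; xRy$. - LfSerial: $\forall y\,\exists x\; xRy$. - Dense: $\forall x,z\,\exists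 y\; (xRz\to xRy\land yRz)$. - IncTrans: $\lnot xRy\land\lnot yRx\land\lnot yRz\land\lnot zRy\to\lnot xRz\land\lnot zRx$. - LfUnique: $x_1Ry\land x_2Ry\to x_1=x_2$. - RgUnique: $xRy_1\land xRy_2\to y_1=y_2$. (Free variables are universally quantified.) A unary operation is a hexadecimal digit $q=8q_8+4q_4+2q_2+q_1\in\{0,\dots,9,A,\dots,F\}$ with bits $q_i\in\{0,1\}$; the relation $R^q$ is defined by $$xR^qy\iff(\lnot xRy\land\lnot yRx\land q_8=1)\lor(\lnot xRy\land yRx\land q_4=1)\lor(xRy\land\lnot yRx\land q_2=1)\lor(xRy\land yRx\land q_1=1).$$ For an operation $q$ and a basic property $\mathit{prop}$, the lifted property $q$-$\mathit{prop}$ holds for $R$ iff $\mathit{prop}$ holds for $R^q$. There are $16\cdot 24=384$ lifted properties. Call two of them equivalent on $X$ if they hold for the same relations $R$ on $X$. **Theorem.** For every finite or infinite set $X$ with at least $7$ elements, the 384 lifted properties fall into exactly $81$ classes with respect to equivalence on $X$. These are the following sets, where e.g. "2,4-Trans" stands for the two members 2-Trans and 4-Trans. (Class 1 consists of the properties that hold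 for no relation and class 2 of those that hold for every relation. Merging classes 3 and 4 gives the "computed partition" into 80 classes, from whose class of 3-Sym the class $\{$2-Dense, 4-Dense$\}$ is split off.) 1. $\{$0,2,4,6-Refl; 9,B,D,F-ASym; F-AntiSym; 9,B,D,F-AntiTrans; 0-LfSerial; B,D,F-LfUnique; 9,B,D,F-Irrefl; B,D,F-CoRefl; 0-SemiConnex; 0,2,4,6-Connex; 0-RgSerial; B,D,F-RgUnique$\}$ 2. $\{$9,B,D,F-Refl; 0,9,B,D,F-LfQuasiRefl; 0,1,6,7,8,9,E,F-Sym; 0,2,4-ASym; 0,2,4-AntiSym; 0,F-Trans; 0-AntiTrans; 0,F-LfEucl; 0,B,D,F-SemiOrd1; 0,B,D,F-SemiOrd2; 9,B,D,F-LfSerial; 0,9,B,D,F-Dense; 0-LfUnique; 0,2,4,6-Irrefl; 0-CoRefl; 0,9,B,D,F-RgQuasiRefl; 0,9,B,D,F-QuasiRefl; B,D,F-SemiConnex; B,D,F-Connex; 0,1,6,7,8,9,E,F-QuasiTrans; 0,F-RgEucl; 9,B,D,F-RgSerial; 0,B,D,F-IncTrans; 0-RgUnique$\}$ 3. $\{$2,4,6-LfQuasiRefl;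 2,3,4,5,A,B,C,D-Sym; 6-ASym; 6-AntiSym; 6-Trans; 2,4,6,B,D-LfEucl; 6,9-SemiOrd1; 9-SemiOrd2; 2,4,6-CoRefl; 2,4,6-RgQuasiRefl; 2,4,6-QuasiRefl; 9-SemiConnex; 9-Connex; 2,4,6,B,D-RgEucl; 9-IncTrans$\}$ 4. $\{$2,4-Dense$\}$ 5. $\{$9,B,D-AntiSym; 9-LfUnique; 9-CoRefl; 2,4,6-SemiConnex; 9-RgUnique$\}$ 6. $\{$1-Trans; 1-LfEucl; E-SemiOrd2; 1-RgEucl; A,C,E-IncTrans$\}$ 7. $\{$7-Trans; 7-LfEucl; 8-SemiOrd2; 7-RgEucl; 8-IncTrans$\}$ 8. $\{$8-Trans; 8-LfEucl; 7-SemiOrd2; 8-RgEucl; 3,5,7-IncTrans$\}$ 9. $\{$9-Trans; 9-LfEucl; 6-SemiOrd2; 9-RgEucl; 2,4,6-IncTrans$\}$ 10. $\{$E-Trans; E-LfEucl; 1-SemiOrd2; E-RgEucl; 1-IncTrans$\}$ 11. $\{$1,3,5-ASym; A,C,E-Connex$\}$ 12. $\{$8,A,C-ASym; 3,5,7-Connex$\}$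 13. $\{$1,3,5-AntiSym; 1-CoRefl; A,C,E-SemiConnex$\}$ 14. $\{$8,A,C-AntiSym; 8-CoRefl; 3,5,7-SemiConnex$\}$ 15. $\{$1,3,5,7-Refl; 8,A,C,E-Irrefl$\}$ 16. $\{$8,A,C,E-Refl; 1,3,5,7-Irrefl$\}$ 17. $\{$1,E-SemiOrd1$\}$ 18. $\{$2,4-SemiOrd1$\}$ 19. $\{$3,5-SemiOrd1$\}$ 20. $\{$7,8-SemiOrd1$\}$ 21. $\{$A,C-SemiOrd1$\}$ 22. $\{$2,4-SemiOrd2$\}$ 23. $\{$3,5-SemiOrd2$\}$ 24. $\{$A,C-SemiOrd2$\}$ 25. $\{$2,4-AntiTrans$\}$ 26. $\{$3,5-AntiTrans$\}$ 27. $\{$A,C-AntiTrans$\}$ 28. $\{$2,4-Trans; 2,3,4,5,A,B,C,D-QuasiTrans$\}$ 29. $\{$3,5-Trans$\}$ 30. $\{$A,C-Trans$\}$ 31. $\{$B,D-Trans$\}$ 32. $\{$3,5-Dense$\}$ 33. $\{$A,C-Dense$\}$ 34. $\{$7-ASym; 8-Connex$\}$ 35. $\{$E-ASym; 1-Connex$\}$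 36. $\{$7-AntiSym; 3,5,7-CoRefl; 8-SemiConnex$\}$ 37. $\{$E-AntiSym; A,C,E-CoRefl; 1-SemiConnex$\}$ 38. $\{$1-AntiTrans$\}$ 39. $\{$6-AntiTrans$\}$ 40. $\{$7-AntiTrans$\}$ 41. $\{$8-AntiTrans$\}$ 42. $\{$E-AntiTrans$\}$ 43. $\{$1-Dense$\}$ 44. $\{$6-Dense$\}$ 45. $\{$7-Dense$\}$ 46. $\{$8-Dense$\}$ 47. $\{$E-Dense$\}$ 48. $\{$3-LfEucl; 5-RgEucl$\}$ 49. $\{$5-LfEucl; 3-RgEucl$\}$ 50. $\{$A-LfEucl; C-RgEucl$\}$ 51. $\{$C-LfEucl; A-RgEucl$\}$ 52. $\{$1-LfSerial; 1-RgSerial$\}$ 53. $\{$2-LfSerial; 4-RgSerial$\}$ 54. $\{$3-LfSerial; 5-RgSerial$\}$ 55. $\{$4-LfSerial; 2-RgSerial$\}$ 56. $\{$5-LfSerial; 3-RgSerial$\}$ 57. $\{$6-LfSerial; 6-RgSerial$\}$ 58. $\{$7-LfSerial; 7-RgSerial$\}$ 59. $\{$8-LfSerial; 8-RgSerial$\}$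 60. $\{$A-LfSerial; C-RgSerial$\}$ 61. $\{$C-LfSerial; A-RgSerial$\}$ 62. $\{$E-LfSerial; E-RgSerial$\}$ 63. $\{$1-LfUnique; 1-RgUnique$\}$ 64. $\{$2-LfUnique; 4-RgUnique$\}$ 65. $\{$3-LfUnique; 5-RgUnique$\}$ 66. $\{$4-LfUnique; 2-RgUnique$\}$ 67. $\{$5-LfUnique; 3-RgUnique$\}$ 68. $\{$6-LfUnique; 6-RgUnique$\}$ 69. $\{$7-LfUnique; 7-RgUnique$\}$ 70. $\{$8-LfUnique; 8-RgUnique$\}$ 71. $\{$A-LfUnique; C-RgUnique$\}$ 72. $\{$C-LfUnique; A-RgUnique$\}$ 73. $\{$E-LfUnique; E-RgUnique$\}$ 74. $\{$1-LfQuasiRefl; 1-RgQuasiRefl; 1-QuasiRefl$\}$ 75. $\{$3-LfQuasiRefl; 5-RgQuasiRefl$\}$ 76. $\{$5-LfQuasiRefl; 3-RgQuasiRefl$\}$ 77. $\{$7-LfQuasiRefl; 7-RgQuasiRefl; 3,5,7-QuasiRefl$\}$ 78. $\{$8-LfQuasiRefl; 8-RgQuasiRefl; 8-QuasiRefl$\}$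 79. $\{$A-LfQuasiRefl; C-RgQuasiRefl$\}$ 80. $\{$C-LfQuasiRefl; A-RgQuasiRefl$\}$ 81. $\{$E-LfQuasiRefl; E-RgQuasiRefl; A,C,E-QuasiRefl$\}$ -/

import Mathlib

namespace RelLift

/-- The 24 basic properties of binary relations. -/
inductive BasicProp
  | Refl | Irrefl | CoRefl | LfQuasiRefl | RgQuasiRefl | QuasiRefl
  | Sym | ASym | AntiSym | SemiConnex | Connex
  | Trans | AntiTrans | QuasiTrans | RgEucl | LfEucl
  | SemiOrd1 | SemiOrd2 | RgSerial | LfSerial | Dense | IncTrans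
  | LfUnique | RgUnique
  deriving DecidableEq

/-- The relation `R` on `X` has the given basic property. -/
def BasicProp.Holds {X : Type*} (R : X → X → Prop) : BasicProp → Prop
  | .Refl => ∀ x, R x x
  | .Irrefl => ∀ x, ¬ R x x
  | .CoRefl => ∀ x y, R x y → x = y
  | .LfQuasiRefl => ∀ x y, R x y → R x x
  | .RgQuasiRefl => ∀ x y, R x y → R y y
  | .QuasiRefl => (∀ x y, R x y → R x x) ∧ (∀ x y, R x y → R y y)
  | .Sym => ∀ x y, R x y → R y x
  | .ASym => ∀ x y, R x y → ¬ R y x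
  | .AntiSym => ∀ x y, R x y ∧ x ≠ y → ¬ R y x
  | .SemiConnex => ∀ x y, R x y ∨ R y x ∨ x = y
  | .Connex => ∀ x y, R x y ∨ R y x
  | .Trans => ∀ x y z, R x y ∧ R y z → R x z
  | .AntiTrans => ∀ x y z, R x y ∧ R y z → ¬ R x z
  | .QuasiTrans => ∀ x y z, R x y ∧ ¬ R y x ∧ R y z ∧ ¬ R z y → R x z ∧ ¬ R z x
  | .RgEucl => ∀ x y z, R x y ∧ R x z → R y z
  | .LfEucl => ∀ x y z, R y x ∧ R z x → R y z
  | .SemiOrd1 => ∀ w x y z, R w x ∧ ¬ R x y ∧ ¬ R y x ∧ R y z → R w z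
  | .SemiOrd2 => ∀ w x y z, R x y ∧ R y z →
      R w x ∨ R x w ∨ R w y ∨ R y w ∨ R w z ∨ R z w
  | .RgSerial => ∀ x, ∃ y, R x y
  | .LfSerial => ∀ y, ∃ x, R x y
  | .Dense => ∀ x z, ∃ y, R x z → R x y ∧ R y z
  | .IncTrans => ∀ x y z, ¬ R x y ∧ ¬ R y x ∧ ¬ R y z ∧ ¬ R z y → ¬ R x z ∧ ¬ R z x
  | .LfUnique => ∀ x₁ x₂ y, R x₁ y ∧ R x₂ y → x₁ = x₂
  | .RgUnique => ∀ x y₁ y₂, R x y₁ ∧ R x y₂ → y₁ = y₂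

/-- A unary operation on relations, encoded by its four bits `q = 8 q₈ + 4 q₄ + 2 q₂ + q₁`.
The hexadecimal digits `A, …, F` are written `10, …, 15`. -/
abbrev Op := Fin 16

/-- The relation `R^q`. -/
def Op.app (q : Op) {X : Type*} (R : X → X → Prop) (x y : X) : Prop :=
  (¬ R x y ∧ ¬ R y x ∧ q.val.testBit 3 = true) ∨
  (¬ R x y ∧ R y x ∧ q.val.testBit 2 = true) ∨
  (R x y ∧ ¬ R y x ∧ q.val.testBit 1 = true) ∨
  (R x y ∧ R y x ∧ q.val.testBit 0 = true)

/-- A lifted property `q-prop`: an operation together with a basic property. -/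
abbrev LiftedProp := Op × BasicProp

/-- `R` has the property `q-prop` if `R^q` has the property `prop`. -/
def LiftedProp.Holds {X : Type*} (l : LiftedProp) (R : X → X → Prop) : Prop :=
  l.2.Holds (Op.app l.1 R)

/-- Extensional equality of lifted properties on the domain `X`. -/
def extEq (X : Type*) : Setoid LiftedProp where
  r p q := ∀ R : X → X → Prop, p.Holds R ↔ q.Holds R
  iseqv := ⟨fun _ _ => Iff.rfl, fun h R => (h R).symm, fun h k R => (h R).trans (k R)⟩

/-- The set of all `q-prop` where `(qs, prop)` is in the list and `q` is in `qs`. -/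
def box (l : List (List Op × BasicProp)) : Finset LiftedProp :=
  (l.flatMap fun e => e.1.map fun q => (q, e.2)).toFinset

/-- The class of `3-Sym` in the computed partition. -/
def symBox : Finset LiftedProp :=
  box [([2,4,6], .LfQuasiRefl), ([2,3,4,5,10,11,12,13], .Sym), ([6], .ASym), ([6], .AntiSym),
    ([6], .Trans), ([2,4,6,11,13], .LfEucl), ([6,9], .SemiOrd1), ([9], .SemiOrd2),
    ([2,4], .Dense), ([2,4,6], .CoRefl), ([2,4,6], .RgQuasiRefl), ([2,4,6], .QuasiRefl),
    ([9], .SemiConnex), ([9], .Connex), ([2,4,6,11,13], .RgEucl), ([9], .IncTrans)]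

/-- The class to be split off from the class of `3-Sym`: `2-Dense` and `4-Dense`. -/
def denseBox : Finset LiftedProp := box [([2,4], .Dense)]

/-- The computed partition of the 384 lifted properties into 80 classes. In each class the members
built from the properties `RgSerial`, `RgEucl`, `RgUnique`, `Irrefl`, `Connex`, `SemiConnex`,
`IncTrans`, `CoRefl`, `QuasiTrans`, `RgQuasiRefl`, `QuasiRefl` come last. -/
def computedPartition : List (Finset LiftedProp) :=
  [
    -- the two trivial classes: satisfied by no relation, and by every relation
    box [([0,2,4,6], .Refl), ([9,11,13,15], .ASym), ([15], .AntiSym), ([9,11,13,15], .AntiTrans),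
      ([0], .LfSerial), ([11,13,15], .LfUnique), ([9,11,13,15], .Irrefl), ([11,13,15], .CoRefl),
      ([0], .SemiConnex), ([0,2,4,6], .Connex), ([0], .RgSerial), ([11,13,15], .RgUnique)],
    box [([9,11,13,15], .Refl), ([0,9,11,13,15], .LfQuasiRefl), ([0,1,6,7,8,9,14,15], .Sym),
      ([0,2,4], .ASym), ([0,2,4], .AntiSym), ([0,15], .Trans), ([0], .AntiTrans),
      ([0,15], .LfEucl), ([0,11,13,15], .SemiOrd1), ([0,11,13,15], .SemiOrd2),
      ([9,11,13,15], .LfSerial), ([0,9,11,13,15], .Dense), ([0], .LfUnique),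
      ([0,2,4,6], .Irrefl), ([0], .CoRefl), ([0,9,11,13,15], .RgQuasiRefl),
      ([0,9,11,13,15], .QuasiRefl), ([11,13,15], .SemiConnex), ([11,13,15], .Connex),
      ([0,1,6,7,8,9,14,15], .QuasiTrans), ([0,15], .RgEucl), ([9,11,13,15], .RgSerial),
      ([0,11,13,15], .IncTrans), ([0], .RgUnique)],
    -- the class of symmetry
    symBox,
    -- the other classes that involve several basic properties
    box [([9,11,13], .AntiSym), ([9], .LfUnique), ([9], .CoRefl), ([2,4,6], .SemiConnex),
      ([9], .RgUnique)],
    box [([1], .Trans), ([1], .LfEucl), ([14], .SemiOrd2), ([1], .RgEucl),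
      ([10,12,14], .IncTrans)],
    box [([7], .Trans), ([7], .LfEucl), ([8], .SemiOrd2), ([7], .RgEucl), ([8], .IncTrans)],
    box [([8], .Trans), ([8], .LfEucl), ([7], .SemiOrd2), ([8], .RgEucl), ([3,5,7], .IncTrans)],
    box [([9], .Trans), ([9], .LfEucl), ([6], .SemiOrd2), ([9], .RgEucl), ([2,4,6], .IncTrans)],
    box [([14], .Trans), ([14], .LfEucl), ([1], .SemiOrd2), ([14], .RgEucl), ([1], .IncTrans)],
    -- pure classes
    box [([1,3,5], .ASym), ([10,12,14], .Connex)],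
    box [([8,10,12], .ASym), ([3,5,7], .Connex)],
    box [([1,3,5], .AntiSym), ([1], .CoRefl), ([10,12,14], .SemiConnex)],
    box [([8,10,12], .AntiSym), ([8], .CoRefl), ([3,5,7], .SemiConnex)],
    box [([1,3,5,7], .Refl), ([8,10,12,14], .Irrefl)],
    box [([8,10,12,14], .Refl), ([1,3,5,7], .Irrefl)],
    box [([1,14], .SemiOrd1)],
    box [([2,4], .SemiOrd1)],
    box [([3,5], .SemiOrd1)],
    box [([7,8], .SemiOrd1)],
    box [([10,12], .SemiOrd1)],
    box [([2,4], .SemiOrd2)],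
    box [([3,5], .SemiOrd2)],
    box [([10,12], .SemiOrd2)],
    box [([2,4], .AntiTrans)],
    box [([3,5], .AntiTrans)],
    box [([10,12], .AntiTrans)],
    box [([2,4], .Trans), ([2,3,4,5,10,11,12,13], .QuasiTrans)],
    box [([3,5], .Trans)],
    box [([10,12], .Trans)],
    box [([11,13], .Trans)],
    box [([3,5], .Dense)],
    box [([10,12], .Dense)],
    -- singleton classes
    box [([7], .ASym), ([8], .Connex)],
    box [([14], .ASym), ([1], .Connex)],
    box [([7], .AntiSym), ([3,5,7], .CoRefl), ([8], .SemiConnex)],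
    box [([14], .AntiSym), ([10,12,14], .CoRefl), ([1], .SemiConnex)],
    box [([1], .AntiTrans)],
    box [([6], .AntiTrans)],
    box [([7], .AntiTrans)],
    box [([8], .AntiTrans)],
    box [([14], .AntiTrans)],
    box [([1], .Dense)],
    box [([6], .Dense)],
    box [([7], .Dense)],
    box [([8], .Dense)],
    box [([14], .Dense)],
    box [([3], .LfEucl), ([5], .RgEucl)],
    box [([5], .LfEucl), ([3], .RgEucl)],
    box [([10], .LfEucl), ([12], .RgEucl)],
    box [([12], .LfEucl), ([10], .RgEucl)],
    box [([1], .LfSerial), ([1], .RgSerial)],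
    box [([2], .LfSerial), ([4], .RgSerial)],
    box [([3], .LfSerial), ([5], .RgSerial)],
    box [([4], .LfSerial), ([2], .RgSerial)],
    box [([5], .LfSerial), ([3], .RgSerial)],
    box [([6], .LfSerial), ([6], .RgSerial)],
    box [([7], .LfSerial), ([7], .RgSerial)],
    box [([8], .LfSerial), ([8], .RgSerial)],
    box [([10], .LfSerial), ([12], .RgSerial)],
    box [([12], .LfSerial), ([10], .RgSerial)],
    box [([14], .LfSerial), ([14], .RgSerial)],
    box [([1], .LfUnique), ([1], .RgUnique)],
    box [([2], .LfUnique), ([4], .RgUnique)],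
    box [([3], .LfUnique), ([5], .RgUnique)],
    box [([4], .LfUnique), ([2], .RgUnique)],
    box [([5], .LfUnique), ([3], .RgUnique)],
    box [([6], .LfUnique), ([6], .RgUnique)],
    box [([7], .LfUnique), ([7], .RgUnique)],
    box [([8], .LfUnique), ([8], .RgUnique)],
    box [([10], .LfUnique), ([12], .RgUnique)],
    box [([12], .LfUnique), ([10], .RgUnique)],
    box [([14], .LfUnique), ([14], .RgUnique)],
    box [([1], .LfQuasiRefl), ([1], .RgQuasiRefl), ([1], .QuasiRefl)],
    box [([3], .LfQuasiRefl), ([5], .RgQuasiRefl)],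
    box [([5], .LfQuasiRefl), ([3], .RgQuasiRefl)],
    box [([7], .LfQuasiRefl), ([7], .RgQuasiRefl), ([3,5,7], .QuasiRefl)],
    box [([8], .LfQuasiRefl), ([8], .RgQuasiRefl), ([8], .QuasiRefl)],
    box [([10], .LfQuasiRefl), ([12], .RgQuasiRefl)],
    box [([12], .LfQuasiRefl), ([10], .RgQuasiRefl)],
    box [([14], .LfQuasiRefl), ([14], .RgQuasiRefl), ([10,12,14], .QuasiRefl)]]

end RelLift

/-! Within a class, equivalence is elementary: instantiating one property at repeated arguments
gives the other, and operations such as 2 and 4 yield converse relations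
(`computedPartition_extEq`). To separate classes on an arbitrary `X`, map `X` onto four points so
that only the fiber of `0` has more than one element. Whether a relation pulled back from these
points has a lifted property is decided on the four points (`lifted_holds_pullback`), so 21 fixed
relations give every property a 21-bit invariant `key`. The keys separate all representatives but
two pairs. A well-order has 9-AntiSym and so separates it from the unsatisfiable class; the Paley
tournament on seven points has 2-Dense but not 3-Sym. Only this tournament needs seven elements; the
four-point map needs five. Since the 81 cells cover all lifted properties, they are exactly the
classes. -/

namespace RelLift

variable {X : Type*}

/-! ### The sixteen operations -/

theorem app_0 (R : X → X → Prop) (x y : X) : Op.app 0 R x y ↔ False := by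
  simp [Op.app, Nat.testBit]

theorem app_1 (R : X → X → Prop) (x y : X) : Op.app 1 R x y ↔ R x y ∧ R y x := by
  simp [Op.app, Nat.testBit]

theorem app_2 (R : X → X → Prop) (x y : X) : Op.app 2 R x y ↔ R x y ∧ ¬ R y x := by
  simp [Op.app, Nat.testBit]

theorem app_3 (R : X → X → Prop) (x y : X) : Op.app 3 R x y ↔ R x y := by
  simp [Op.app, Nat.testBit]; tauto

theorem app_4 (R : X → X → Prop) (x y : X) : Op.app 4 R x y ↔ ¬ R x y ∧ R y x := by
  simp [Op.app, Nat.testBit]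

theorem app_5 (R : X → X → Prop) (x y : X) : Op.app 5 R x y ↔ R y x := by
  simp [Op.app, Nat.testBit]; tauto

theorem app_6 (R : X → X → Prop) (x y : X) : Op.app 6 R x y ↔
    (R x y ∧ ¬ R y x ∨ ¬ R x y ∧ R y x) := by
  simp [Op.app, Nat.testBit]; tauto

theorem app_7 (R : X → X → Prop) (x y : X) : Op.app 7 R x y ↔ R x y ∨ R y x := by
  simp [Op.app, Nat.testBit]; tauto

theorem app_8 (R : X → X → Prop) (x y : X) : Op.app 8 R x y ↔ ¬ R x y ∧ ¬ R y x := by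
  simp [Op.app, Nat.testBit]

theorem app_9 (R : X → X → Prop) (x y : X) : Op.app 9 R x y ↔ (R x y ↔ R y x) := by
  simp [Op.app, Nat.testBit]; tauto

theorem app_10 (R : X → X → Prop) (x y : X) : Op.app 10 R x y ↔ ¬ R y x := by
  simp [Op.app, Nat.testBit]; tauto

theorem app_11 (R : X → X → Prop) (x y : X) : Op.app 11 R x y ↔ (R y x → R x y) := by
  simp [Op.app, Nat.testBit]; tauto

theorem app_12 (R : X → X → Prop) (x y : X) : Op.app 12 R x y ↔ ¬ R x y := by
  simp [Op.app, Nat.testBit]; tauto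

theorem app_13 (R : X → X → Prop) (x y : X) : Op.app 13 R x y ↔ (R x y → R y x) := by
  simp [Op.app, Nat.testBit]; tauto

theorem app_14 (R : X → X → Prop) (x y : X) : Op.app 14 R x y ↔ ¬ (R x y ∧ R y x) := by
  simp [Op.app, Nat.testBit]; tauto

theorem app_15 (R : X → X → Prop) (x y : X) : Op.app 15 R x y ↔ True := by
  simp [Op.app, Nat.testBit]; tauto

/-! ### Lists of lifted properties -/

theorem mem_box {L : List (List Op × BasicProp)} {l : LiftedProp} :
    l ∈ box L ↔ ∃ e ∈ L, ∃ q ∈ e.1, (q, e.2) = l := by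
  simp [box]

theorem forall_mem_box {L : List (List Op × BasicProp)} {P : LiftedProp → Prop} :
    (∀ l ∈ box L, P l) ↔ ∀ e ∈ L, ∀ q ∈ e.1, P (q, e.2) := by
  simp only [mem_box]
  constructor
  · exact fun h e he q hq => h _ ⟨e, he, q, hq, rfl⟩
  · rintro h _ ⟨e, he, q, hq, rfl⟩
    exact h e he q hq

/-- A representative of each class of the computed partition, together with the number whose
binary digits tell which of the relations in `witnesses` have the property. -/
def keyedReps : List (LiftedProp × ℕ) :=
  [((0, .Refl), 0), ((9, .Refl), 2097151), ((3, .Sym), 1968384), ((9, .AntiSym), 0),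
    ((1, .Trans), 1914016), ((7, .Trans), 1901186), ((8, .Trans), 1595161),
    ((9, .Trans), 1973520), ((14, .Trans), 1581344), ((1, .ASym), 1056800), ((8, .ASym), 524800),
    ((1, .AntiSym), 1324064), ((8, .AntiSym), 541457), ((1, .Refl), 721600),
    ((8, .Refl), 1091620), ((1, .SemiOrd1), 1865000), ((2, .SemiOrd1), 2071822),
    ((3, .SemiOrd1), 1840906), ((7, .SemiOrd1), 1840899), ((10, .SemiOrd1), 1848618),
    ((2, .SemiOrd2), 2088382), ((3, .SemiOrd2), 1595193), ((10, .SemiOrd2), 1914018),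
    ((2, .AntiTrans), 2097143), ((3, .AntiTrans), 1058848), ((10, .AntiTrans), 655936),
    ((2, .Trans), 2071950), ((3, .Trans), 1905792), ((10, .Trans), 1578248),
    ((11, .Trans), 1973504), ((3, .Dense), 2054091), ((10, .Dense), 1965374),
    ((7, .ASym), 1048576), ((14, .ASym), 524288), ((7, .AntiSym), 1310720),
    ((14, .AntiSym), 524544), ((1, .AntiTrans), 1058852), ((6, .AntiTrans), 2080215),
    ((7, .AntiTrans), 1058816), ((8, .AntiTrans), 656064), ((14, .AntiTrans), 655424),
    ((1, .Dense), 2095099), ((6, .Dense), 1968896), ((7, .Dense), 2054107),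
    ((8, .Dense), 1965887), ((14, .Dense), 1966014), ((3, .LfEucl), 1839104),
    ((5, .LfEucl), 1836032), ((10, .LfEucl), 1574144), ((12, .LfEucl), 1577216),
    ((1, .LfSerial), 721861), ((2, .LfSerial), 32), ((3, .LfSerial), 775157),
    ((4, .LfSerial), 16384), ((5, .LfSerial), 739293), ((6, .LfSerial), 21688),
    ((7, .LfSerial), 776189), ((8, .LfSerial), 1419430), ((10, .LfSerial), 1420462),
    ((12, .LfSerial), 1439990), ((14, .LfSerial), 1441022), ((1, .LfUnique), 1326112),
    ((2, .LfUnique), 2046343), ((3, .LfUnique), 1325056), ((4, .LfUnique), 2002258),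
    ((5, .LfUnique), 1313792), ((6, .LfUnique), 1968386), ((7, .LfUnique), 1312768),
    ((8, .LfUnique), 672593), ((10, .LfUnique), 655617), ((12, .LfUnique), 655680),
    ((14, .LfUnique), 655616), ((1, .LfQuasiRefl), 2045666), ((3, .LfQuasiRefl), 2036418),
    ((5, .LfQuasiRefl), 2033346), ((7, .LfQuasiRefl), 2032322), ((8, .LfQuasiRefl), 1638205),
    ((10, .LfQuasiRefl), 1617196), ((12, .LfQuasiRefl), 1620276), ((14, .LfQuasiRefl), 1616164)]

/-! ### Members of one class are equivalent -/

/-- Density is self-converse, which pairs the operations 2 and 4, 3 and 5, 10 and 12. -/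
theorem dense_swap (R : X → X → Prop) :
    BasicProp.Holds (fun x y => R y x) .Dense ↔ BasicProp.Holds R .Dense := by
  simp only [BasicProp.Holds]
  rw [forall_comm]
  simp only [and_comm]

set_option maxHeartbeats 2000000 in
theorem computedPartition_extEq [Nontrivial X] :
    List.Forall₂ (fun B r => ∀ l ∈ B, l ∉ denseBox → extEq X l r.1)
      computedPartition keyedReps := by
  obtain ⟨a, b, hab⟩ := exists_pair_ne X
  simp only [computedPartition, symBox, keyedReps, List.forall₂_cons, forall_mem_box,
    List.forall_mem_cons, List.not_mem_nil, false_imp_iff, implies_true, and_true,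
    List.forall₂_nil_right_iff]
  refine ⟨?_, ?_, ?_, ?_⟩
  · and_intros
    all_goals
      intro hl R
      simp only [LiftedProp.Holds, BasicProp.Holds, app_0, app_2, app_4, app_6, app_9, app_11,
        app_13, app_15] <;>
      refine iff_of_false (fun h => ?_) (fun h => h a) <;>
      first
      | grind
      | (have := h a; grind)
      | (have := h a a; have := h a b; grind)
      -- These instances suit `LfUnique` and `RgUnique`: operations 11, 13, 15 are reflexive and
      -- relate `a` and `b` in some direction, which forces `a = b`.
      | (have := h a a b; have := h a b a; have := h b a b; have := h b b a; grind)
  · and_intros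
    all_goals
      intro hl R
      simp only [LiftedProp.Holds, BasicProp.Holds, app_0, app_1, app_2, app_4, app_6, app_7,
        app_8, app_9, app_11, app_13, app_14, app_15] <;>
      first
      | grind
      | exact iff_of_true (fun x => ⟨x, by tauto⟩) (by tauto)
      | exact iff_of_true (fun x z => ⟨x, by tauto⟩) (by tauto)
  · and_intros
    all_goals
      intro hl R
      simp only [LiftedProp.Holds, BasicProp.Holds, app_2, app_3, app_4, app_5, app_6, app_9,
        app_10, app_11, app_12, app_13] <;>
      first
      | grind
      | exact ⟨fun h x y => by have := h x x y; have := h y y x; grind, by grind⟩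
      -- Suits 6-SemiOrd1: if 6 related `x` to `y`, this instance would relate `x` to itself, but 6
      -- is irreflexive.
      | exact ⟨fun h x y hxy => by have := h x y y x; tauto,
          fun h w x y z hw => by have := h w x; have := h x w; tauto⟩
      | exact absurd (by decide) hl
  · and_intros
    all_goals
      intro hl R
      simp only [LiftedProp.Holds, BasicProp.Holds, app_1, app_2, app_3, app_4, app_5, app_6,
        app_7, app_8, app_9, app_10, app_11, app_12, app_13, app_14] <;>
      first
      | grind
      | exact forall_congr' fun x => exists_congr fun y => by tauto
      | exact forall₂_congr fun x y => by tauto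
      | exact dense_swap _
      | exact ⟨fun h x y => by
          have := h x x y; have := h x y x; have := h x y y; have := h y x x; grind, by grind⟩

/-! ### Relations pulled back from a finite set -/

/-- The properties with every equation `x = y` read as `E x y`. -/
def BasicProp.HoldsWith {V : Type*} (E S : V → V → Prop) : BasicProp → Prop
  | .CoRefl => ∀ x y, S x y → E x y
  | .AntiSym => ∀ x y, S x y ∧ ¬ E x y → ¬ S y x
  | .SemiConnex => ∀ x y, S x y ∨ S y x ∨ E x y
  | .LfUnique => ∀ x₁ x₂ y, S x₁ y ∧ S x₂ y → E x₁ x₂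
  | .RgUnique => ∀ x y₁ y₂, S x y₁ ∧ S x y₂ → E y₁ y₂
  | p => p.Holds S

instance {V : Type*} [Fintype V] (E S : V → V → Prop) [DecidableRel E] [DecidableRel S]
    (p : BasicProp) : Decidable (p.HoldsWith E S) := by
  cases p <;> dsimp only [BasicProp.HoldsWith, BasicProp.Holds] <;> infer_instance

instance {V : Type*} (q : Op) (S : V → V → Prop) [DecidableRel S] : DecidableRel (q.app S) :=
  fun _ _ => by unfold Op.app; infer_instance

/-- For a surjection `f` such that `E` holds exactly between points whose fibers cannot contain
distinct elements, the properties of a pullback along `f` can be read off from the base. -/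
theorem holds_pullback {V : Type*} {f : X → V} (hf : f.Surjective) {E : V → V → Prop}
    (hE : ∀ i j, E i j ↔ ∀ x y, f x = i → f y = j → x = y) (S : V → V → Prop) (p : BasicProp) :
    p.Holds (fun x y => S (f x) (f y)) ↔ p.HoldsWith E S := by
  cases p
  -- Equality occurs here only as a conclusion, up to logic. The other conditions are constant on
  -- fibers, so quantifying over the fibers turns `x = y` into `E`.
  case CoRefl | AntiSym | SemiConnex | LfUnique | RgUnique =>
    simp only [BasicProp.Holds, BasicProp.HoldsWith, hE, hf.forall]
    grind
  all_goals simp only [BasicProp.Holds, BasicProp.HoldsWith, hf.forall, hf.exists]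

theorem lifted_holds_pullback {V : Type*} {f : X → V} (hf : f.Surjective) {E : V → V → Prop}
    (hE : ∀ i j, E i j ↔ ∀ x y, f x = i → f y = j → x = y) (S : V → V → Prop) (l : LiftedProp) :
    l.Holds (fun x y => S (f x) (f y)) ↔ l.2.HoldsWith E (l.1.app S) :=
  holds_pullback hf hE (l.1.app S) l.2

theorem nonempty_embedding_fin (hX : 7 ≤ ENat.card X) : Nonempty (Fin 7 ↪ X) := by
  rw [← Set.encard_univ] at hX
  obtain ⟨t, -, ht⟩ := Set.exists_subset_encard_eq hX
  have hn : Nat.card t = 7 := by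
    rw [Nat.card_coe_set_eq, Set.ncard, ht]; rfl
  have : Finite t := Nat.finite_of_card_ne_zero (by omega)
  exact ⟨(Finite.equivFinOfCardEq hn).symm.toEmbedding.trans (Function.Embedding.subtype _)⟩

/-- Equality on four points of which the point `0` stands for several elements. -/
abbrev fatEq (i j : Fin 4) : Prop := i = j ∧ i ≠ 0

theorem exists_fat_surjective (hX : 7 ≤ ENat.card X) : ∃ f : X → Fin 4, f.Surjective ∧
    ∀ i j, fatEq i j ↔ ∀ x y, f x = i → f y = j → x = y := by
  classical
  obtain ⟨g⟩ := nonempty_embedding_fin hX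
  have hg : ∀ a b, g a = g b ↔ a = b := fun a b => g.injective.eq_iff
  let f : X → Fin 4 := fun x => if x = g 1 then 1 else if x = g 2 then 2 else
    if x = g 3 then 3 else 0
  have h0 : f (g 0) = 0 := by simp [f, hg]
  have h1 : f (g 1) = 1 := by simp [f]
  have h2 : f (g 2) = 2 := by simp [f, hg]
  have h3 : f (g 3) = 3 := by simp [f, hg]
  -- A second element over `0`, which makes that fiber fat.
  have h4 : f (g 4) = 0 := by simp [f, hg]
  have hf : f.Surjective := by
    intro i
    fin_cases i
    exacts [⟨_, h0⟩, ⟨_, h1⟩, ⟨_, h2⟩, ⟨_, h3⟩]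
  refine ⟨f, hf, fun i j => ⟨?_, fun h => ?_⟩⟩
  · rintro ⟨rfl, hi⟩ x y hx hy
    subst hx
    simp only [f] at hi hy
    grind
  · obtain ⟨x, hx⟩ := hf i
    obtain ⟨y, hy⟩ := hf j
    have hxy := h x y hx hy
    have hij : i = j := by rw [← hx, ← hy, hxy]
    refine ⟨hij, fun hi => ?_⟩
    have := h _ _ (h0.trans hi.symm) (h4.trans (hi.symm.trans hij))
    rw [hg] at this
    exact absurd this (by decide)

/-! ### Separation by relations on four points -/

/-- The relation on `Fin n` whose adjacency matrix has the entries of `c` in binary. -/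
abbrev codeRel (n c : ℕ) (i j : Fin n) : Prop := c.testBit (n * i + j) = true

/-- Codes of relations on four points that tell the classes apart. -/
def witnesses : List ℕ :=
  [64987, 59104, 19282, 52700, 23439, 16650, 56895, 34209, 64511, 59387, 17476, 576, 240, 320,
    25083, 22798, 37921, 64959, 32768, 65535, 0]

/-- The number whose binary digits tell which witnesses have the property. -/
def key (l : LiftedProp) : ℕ :=
  Nat.ofBits fun i : Fin witnesses.length =>
    decide (l.2.HoldsWith fatEq (l.1.app (codeRel 4 witnesses[i])))

/-- Each bit of the key is the truth value of the property at an actual relation on `X`, the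
pullback of a witness. -/
theorem key_eq_of_extEq (hX : 7 ≤ ENat.card X) {l m : LiftedProp} (h : extEq X l m) :
    key l = key m := by
  obtain ⟨f, hf, hE⟩ := exists_fat_surjective hX
  unfold key
  congr 1
  funext i
  rw [decide_eq_decide, ← lifted_holds_pullback hf hE, ← lifted_holds_pullback hf hE]
  exact h _

set_option maxRecDepth 10000 in
theorem key_keyedReps : ∀ r ∈ keyedReps, key r.1 = r.2 := by
  decide +kernel

/-! ### The two pairs with equal keys -/

/-- The relation of the Paley tournament on seven points: `j - i` is a nonzero square. -/
abbrev paley (i j : Fin 7) : Prop := j - i = 1 ∨ j - i = 2 ∨ j - i = 4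

/-- The tournament is dense because modulo 7 every nonzero square is a sum of two: `1 = 4 + 4`, `2 =
1 + 1`, `4 = 2 + 2`. -/
theorem not_extEq_sym_dense (hX : 7 ≤ ENat.card X) : ¬ extEq X (3, .Sym) (2, .Dense) := by
  intro h
  obtain ⟨g⟩ := nonempty_embedding_fin hX
  obtain ⟨f, hf⟩ : ∃ f : X → Fin 7, f.Surjective :=
    ⟨_, (Function.leftInverse_invFun g.injective).surjective⟩
  have hs := h fun x y => paley (f x) (f y)
  -- The fibers are arbitrary: neither property mentions equality, so `E` may be whatever the fibers
  -- dictate.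
  rw [lifted_holds_pullback hf fun _ _ => Iff.rfl, lifted_holds_pullback hf fun _ _ => Iff.rfl]
    at hs
  revert hs
  change ¬ (BasicProp.Holds (Op.app 3 paley) .Sym ↔ BasicProp.Holds (Op.app 2 paley) .Dense)
  simp only [BasicProp.Holds, app_2, app_3]
  decide +kernel

/-- No pullback with a fat fiber can have 9-AntiSym, since two elements of that fiber are related
symmetrically. A linear order on `X` has it. -/
theorem not_extEq_refl_antiSym [Nonempty X] : ¬ extEq X (0, .Refl) (9, .AntiSym) := by
  intro h
  have hs := h WellOrderingRel
  simp only [LiftedProp.Holds, BasicProp.Holds, app_0, app_9, forall_const, false_iff] at hs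
  refine hs fun x y ⟨h₁, hxy⟩ _ => ?_
  rcases trichotomous_of WellOrderingRel x y with h₂ | h₂ | h₂
  · exact asymm_of WellOrderingRel h₂ (h₁.1 h₂)
  · exact hxy h₂
  · exact asymm_of WellOrderingRel h₂ (h₁.2 h₂)

/-! ### The classes -/

/-- The classes, each with a representative and its key. -/
def cells : List (Finset LiftedProp × LiftedProp × ℕ) :=
  (computedPartition.zip keyedReps).map (fun c => (c.1 \ denseBox, c.2)) ++
    [(denseBox, (2, .Dense), 1968384)]

set_option maxHeartbeats 2000000 in
theorem exists_mem_cells (l : LiftedProp) : ∃ c ∈ cells, l ∈ c.1 := by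
  obtain ⟨q, p⟩ := l
  cases p <;> revert q <;> decide +kernel

theorem nodup_cells : cells.Nodup :=
  List.Nodup.of_map (fun c => c.2.1) (by decide +kernel)

theorem length_cells : cells.length = 81 := by
  decide +kernel

theorem sdiff_denseBox : ∀ B ∈ computedPartition, B ≠ symBox → B \ denseBox = B := by
  decide +kernel

theorem extEq_of_mem_cell [Nontrivial X] {c : Finset LiftedProp × LiftedProp × ℕ}
    (hc : c ∈ cells) {l : LiftedProp} (hl : l ∈ c.1) : extEq X l c.2.1 := by
  simp only [cells, List.mem_append, List.mem_map, List.mem_singleton] at hc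
  rcases hc with ⟨d, hd, rfl⟩ | rfl
  · obtain ⟨h₁, h₂⟩ := Finset.mem_sdiff.1 hl
    exact (List.forall₂_iff_zip.1 computedPartition_extEq).2 hd l h₁ h₂
  · simp only [denseBox, box, List.flatMap_cons, List.map_cons, List.map_nil,
      List.flatMap_nil, List.append_nil, List.mem_toFinset, List.mem_cons, List.not_mem_nil,
      or_false] at hl
    rcases hl with rfl | rfl
    · exact (extEq X).refl _
    · intro R
      simp only [LiftedProp.Holds]
      rw [← dense_swap]
      simp only [BasicProp.Holds, app_2, app_4, and_comm]

theorem key_of_mem_cells : ∀ c ∈ cells, key c.2.1 = c.2.2 := by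
  intro c hc
  simp only [cells, List.mem_append, List.mem_map, List.mem_singleton] at hc
  rcases hc with ⟨d, hd, rfl⟩ | rfl
  · exact key_keyedReps _ (List.of_mem_zip (a := d.1) (b := d.2) hd).2
  · decide +kernel

theorem pairwise_cells : cells.Pairwise fun c d => c.2.2 ≠ d.2.2 ∨
    c.2.1 = (0, .Refl) ∧ d.2.1 = (9, .AntiSym) ∨ c.2.1 = (3, .Sym) ∧ d.2.1 = (2, .Dense) := by
  decide +kernel

theorem eq_of_extEq_of_mem_cells (hX : 7 ≤ ENat.card X) {c d : Finset LiftedProp × LiftedProp × ℕ}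
    (hc : c ∈ cells) (hd : d ∈ cells) (h : extEq X c.2.1 d.2.1) : c = d := by
  have : Nonempty X := (nonempty_embedding_fin hX).map fun g => g 0
  have key_ne : ∀ {c d}, c ∈ cells → d ∈ cells → extEq X c.2.1 d.2.1 → c.2.2 = d.2.2 :=
    fun hc hd h => by
      rw [← key_of_mem_cells _ hc, ← key_of_mem_cells _ hd, key_eq_of_extEq hX h]
  have hp : cells.Pairwise fun c d => extEq X c.2.1 d.2.1 → c = d := by
    refine pairwise_cells.imp_of_mem fun hc hd hcd h => ?_
    rcases hcd with hk | ⟨h₁, h₂⟩ | ⟨h₁, h₂⟩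
    · exact absurd (key_ne hc hd h) hk
    · exact absurd (h₁ ▸ h₂ ▸ h) not_extEq_refl_antiSym
    · exact absurd (h₁ ▸ h₂ ▸ h) (not_extEq_sym_dense hX)
  -- `Pairwise` compares only earlier with later entries; symmetry covers the other order.
  have : Std.Symm fun c d : Finset LiftedProp × LiftedProp × ℕ => extEq X c.2.1 d.2.1 → c = d :=
    ⟨fun c d h h' => (h ((extEq X).symm h')).symm⟩
  exact hp.forall_of_forall (fun _ _ _ => rfl) hc hd h

/-- Covering, equivalence inside cells and inequivalence of representatives suffice; disjointness of
the cells needs no check of its own. -/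
theorem setOf_extEq_eq_cell (hX : 7 ≤ ENat.card X) [Nontrivial X]
    {c : Finset LiftedProp × LiftedProp × ℕ} (hc : c ∈ cells) {l : LiftedProp}
    (hl : extEq X l c.2.1) : {x | extEq X x l} = (c.1 : Set LiftedProp) := by
  ext x
  constructor
  · intro hx
    obtain ⟨d, hd, hxd⟩ := exists_mem_cells x
    have hdc : extEq X d.2.1 c.2.1 := (extEq X).trans
      ((extEq X).symm (extEq_of_mem_cell hd hxd)) ((extEq X).trans hx hl)
    rwa [eq_of_extEq_of_mem_cells hX hd hc hdc] at hxd
  · exact fun hx => (extEq X).trans (extEq_of_mem_cell hc hx) ((extEq X).symm hl)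

theorem classes_extEq (hX : 7 ≤ ENat.card X) [Nontrivial X] :
    (extEq X).classes = (fun c => (c.1 : Set LiftedProp)) '' {c | c ∈ cells} := by
  ext C
  constructor
  · rintro ⟨l, rfl⟩
    obtain ⟨c, hc, hl⟩ := exists_mem_cells l
    exact ⟨c, hc, (setOf_extEq_eq_cell hX hc (extEq_of_mem_cell hc hl)).symm⟩
  · rintro ⟨c, hc, rfl⟩
    exact ⟨c.2.1, (setOf_extEq_eq_cell hX hc ((extEq X).refl _)).symm⟩

theorem ncard_classes_extEq (hX : 7 ≤ ENat.card X) [Nontrivial X] :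
    (extEq X).classes.ncard = 81 := by
  rw [classes_extEq hX, Set.InjOn.ncard_image]
  · rw [← List.coe_toFinset, Set.ncard_coe_finset, List.toFinset_card_of_nodup nodup_cells,
      length_cells]
  · intro c hc d hd hcd
    -- A representative lies in its own cell, so equal cells have equivalent representatives.
    have h : c.2.1 ∈ (c.1 : Set LiftedProp) := by
      rw [← setOf_extEq_eq_cell (X := X) hX hc ((extEq X).refl _)]
      exact (extEq X).refl _
    rw [show (c.1 : Set LiftedProp) = d.1 from hcd] at h
    exact eq_of_extEq_of_mem_cells hX hc hd (extEq_of_mem_cell hd h)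

theorem mem_image_cells {C : Set LiftedProp} :
    C ∈ (fun c => (c.1 : Set LiftedProp)) '' {c | c ∈ cells} ↔
      (∃ B ∈ computedPartition, C = ↑(B \ denseBox)) ∨ C = ↑denseBox := by
  have hmap : cells.map Prod.fst = computedPartition.map (· \ denseBox) ++ [denseBox] := by
    have : computedPartition.map (· \ denseBox) =
        ((computedPartition.zip keyedReps).map Prod.fst).map (· \ denseBox) := by
      -- Zipping loses no class because there are enough representatives.
      rw [List.map_fst_zip (by decide +kernel)]
    simp only [cells, this, List.map_append, List.map_map, List.map_cons, List.map_nil]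
    rfl
  have : C ∈ (fun c => (c.1 : Set LiftedProp)) '' {c | c ∈ cells} ↔
      ∃ B ∈ cells.map Prod.fst, C = ↑B := by
    simp [eq_comm]
  rw [this, hmap]
  simp only [List.mem_append, List.mem_map, List.mem_singleton]
  constructor
  · rintro ⟨_, ⟨B, hB, rfl⟩ | rfl, rfl⟩
    exacts [Or.inl ⟨B, hB, rfl⟩, Or.inr rfl]
  · rintro (⟨B, hB, rfl⟩ | rfl)
    exacts [⟨_, Or.inl ⟨B, hB, rfl⟩, rfl⟩, ⟨_, Or.inr rfl, rfl⟩]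

end RelLift

theorem mainTheorem1 {X : Type*} (hX : 7 ≤ ENat.card X) :
    (RelLift.extEq X).classes =
      {C : Set RelLift.LiftedProp | ∃ B ∈ RelLift.computedPartition,
        B ≠ RelLift.symBox ∧ C = (B : Set RelLift.LiftedProp)} ∪
      {((RelLift.symBox \ RelLift.denseBox : Finset RelLift.LiftedProp) :
          Set RelLift.LiftedProp),
        (RelLift.denseBox : Set RelLift.LiftedProp)} ∧
    (RelLift.extEq X).classes.ncard = 81 := by
  obtain ⟨g⟩ := RelLift.nonempty_embedding_fin hX
  have : Nontrivial X := g.injective.nontrivial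
  refine ⟨?_, RelLift.ncard_classes_extEq hX⟩
  rw [RelLift.classes_extEq hX]
  ext C
  rw [RelLift.mem_image_cells]
  simp only [Set.mem_union, Set.mem_ofPred_eq, Set.mem_insert_iff, Set.mem_singleton_iff,
    ← or_assoc]
  refine or_congr_left ⟨?_, ?_⟩
  · rintro ⟨B, hB, rfl⟩
    by_cases h : B = RelLift.symBox
    · exact Or.inr (by rw [h])
    · exact Or.inl ⟨B, hB, h, by rw [RelLift.sdiff_denseBox B hB h]⟩
  · rintro (⟨B, hB, h, rfl⟩ | rfl)
    · exact ⟨B, hB, by rw [RelLift.sdiff_denseBox B hB h]⟩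
    · exact ⟨_, by simp [RelLift.computedPartition], rfl⟩
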